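/- Let $Q$ be a Stonean compact, i.e. an extremally disconnected compact Hausdorff space. Let $C_\infty(Q,\mathbb R)$ be the set of continuous functions $f:Q\to[-\infty,+\infty]$ that are infinite only on a nowhere dense set, ordered pointwise; sum and product of $f,g$ are the unique continuous extensions to $Q$ of the pointwise sum and product on the dense open set where both are finite. Let $C_\infty(Q,\mathbb C)=C_\infty(Q,\mathbb R)\dotplus iC_\infty(Q,\mathbb R)$, with conjugation $\overline f$ and modulus $|f|\in C_\infty(Q,\mathbb R)$. A continuous fiber bundle of $C^*$-algebras over $Q$ consists of a (not necessarily unital) $C^*$-algebra $\mathfrak X(q)$ for each $q\in Q$ and a complex vector subspace $\mathfrak C\subset\prod_{q\in Q}\mathfrak X(q)$ such that: $q\mapsto\|s(q)\|$ is continuous for every $s\in\mathfrak C$; $\{s(q):s\in\mathfrak C\}$ is dense in $\mathfrak X(q)$ for every $q\in Q$; and $\mathfrak C$ is closed under pointwise product and involution. The disjoint union of the fibers carries the topology generated by the tubes $\{x\in\mathfrak X(q): q\in V,\ \|x-s(q)\|<\varepsilon\}$ ($s\in\mathfrak C$, $V\subset Q$ open, $\varepsilon>0$). An almost global section is a continuous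 section $u$ defined on a comeager set $\mathrm{dom}(u)\subset Q$; write $u\sim v$ if $u=v$ on $\mathrm{dom}(u)\cap\mathrm{dom}(v)$. Let $C_\infty(Q,\mathfrak X)$ be the set of $\sim$-classes, with addition, multiplication, involution, and multiplication by complex numbers and by elements of $C_\infty(Q,\mathbb C)$ induced by the pointwise operations on common domains (for $f\in C_\infty(Q,\mathbb C)$, on the part of $\mathrm{dom}(u)$ where $f$ is finite). Let $\|\hat u\|\in C_\infty(Q,\mathbb R)$ be the unique continuous extension to $Q$ of $q\mapsto\|u(q)\|$, $q\in\mathrm{dom}(u)$. **Theorem.** For every continuous fiber bundle $\mathfrak X$ of $C^*$-algebras over a Stonean compact $Q$, $C_\infty(Q,\mathfrak X)$ is a $C^*$-algebra over $C_\infty(Q,\mathbb C)$. That is: 1. $C_\infty(Q,\mathfrak X)$ is a complex $*$-algebra and a module over $C_\infty(Q,\mathbb C)$ (the constants acting as the complex scalars), with $(fu)^*=\overline f u^*$ and $(fu)v=f(uv)=u(fv)$ for all $f\in C_\infty(Q,\mathbb C)$ and $u,v\in C_\infty(Q,\mathfrak X)$. 2. $\|\cdot\|$ turns $C_\infty(Q,\mathfrak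 X)$ into a Banach–Kantorovich space, i.e. (a) $\|u\|\ge 0$; $\|u\|=0$ iff $u=0$; $\|\lambda u\|=|\lambda|\,\|u\|$ for $\lambda\in\mathbb C$; and $\|u+v\|\le\|u\|+\|v\|$; (b) the norm is decomposable: if $\|u\|=e_1+e_2$ with $e_1,e_2\ge0$ in $C_\infty(Q,\mathbb R)$, then $u=u_1+u_2$ for some $u_1,u_2$ with $\|u_1\|=e_1$ and $\|u_2\|=e_2$; (c) the space is $bo$-complete: every net $(u_\alpha)_{\alpha\in A}$ for which $(u_\alpha-u_\beta)_{(\alpha,\beta)\in A\times A}$ $bo$-converges to $0$ is $bo$-convergent. Here a net $(x_\alpha)$ $bo$-converges to $x$ if there is a decreasing net $(e_\gamma)_{\gamma\in\Gamma}$ in $C_\infty(Q,\mathbb R)$ with infimum $0$ such that for every $\gamma$ there is $\alpha(\gamma)$ with $\|x-x_\alpha\|\le e_\gamma$ for all $\alpha\ge\alpha(\gamma)$. 3. $\|fu\|=|f|\,\|u\|$ for all $f\in C_\infty(Q,\mathbb C)$ and $u\in C_\infty(Q,\mathfrak X)$. 4. $\|uv\|\le\|u\|\,\|v\|$, $\ \|u^*\|=\|u\|$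 and $\|u^*u\|=\|u\|^2$ for all $u,v\in C_\infty(Q,\mathfrak X)$. -/

import Mathlib

open Set Filter Topology

universe u v w

namespace StoneanBundle

/-! ### Extended continuous functions -/

/-- `C_∞(Q, ℝ)`: the continuous functions `Q → [-∞, +∞]` that take the values `±∞` only on a
nowhere dense set. -/
structure CInfReal (Q : Type u) [TopologicalSpace Q] : Type u where
  toFun : Q → EReal
  continuous_toFun : Continuous toFun
  nowhereDense_infinite : IsNowhereDense {q | toFun q = ⊤ ∨ toFun q = ⊥}

namespace CInfReal

variable {Q : Type u} [TopologicalSpace Q]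

theorem toFun_injective : Function.Injective (toFun : CInfReal Q → Q → EReal) := by
  rintro ⟨f, _, _⟩ ⟨g, _, _⟩ h
  simpa using h

/-- The pointwise order. -/
noncomputable instance : PartialOrder (CInfReal Q) := PartialOrder.lift toFun toFun_injective

/-- The set of points at which `f` is finite. -/
def finite (f : CInfReal Q) : Set Q := {q | f.toFun q ≠ ⊤ ∧ f.toFun q ≠ ⊥}

/-- The real value of `f`; it is meaningful on `f.finite`. -/
noncomputable def val (f : CInfReal Q) (q : Q) : ℝ := (f.toFun q).toReal

theorem isOpen_finite (f : CInfReal Q) : IsOpen f.finite :=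
  (isOpen_ne.preimage f.continuous_toFun).inter (isOpen_ne.preimage f.continuous_toFun)

theorem dense_finite (f : CInfReal Q) : Dense f.finite := by
  have h := f.nowhereDense_infinite
  rw [IsNowhereDense, interior_eq_empty_iff_dense_compl] at h
  refine h.mono fun q hq => ?_
  have h' : ¬ (f.toFun q = ⊤ ∨ f.toFun q = ⊥) := fun h'' => hq (subset_closure h'')
  exact not_or.mp h'

theorem finite_mem_residual (f : CInfReal Q) : f.finite ∈ residual Q :=
  residual_of_dense_open f.isOpen_finite f.dense_finite

theorem continuousOn_val (f : CInfReal Q) : ContinuousOn f.val f.finite := by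
  refine EReal.continuousOn_toReal.comp f.continuous_toFun.continuousOn ?_
  intro q hq
  simpa [finite, and_comm, not_or] using hq

/-- Elements of `C_∞(Q, ℝ)` that agree on a dense set are equal. -/
theorem eq_of_dense {f g : CInfReal Q} {D : Set Q} (hD : Dense D)
    (h : ∀ q ∈ D, f.toFun q = g.toFun q) : f = g :=
  toFun_injective (Continuous.ext_on hD f.continuous_toFun g.continuous_toFun h)

/-- The constant functions. -/
def const (c : ℝ) : CInfReal Q where
  toFun := fun _ => c
  continuous_toFun := continuous_const
  nowhereDense_infinite := by simp

theorem dense_finite_inter (f g : CInfReal Q) : Dense (f.finite ∩ g.finite) :=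
  f.dense_finite.inter_of_isOpen_left g.dense_finite f.isOpen_finite

theorem continuous_val_left (f g : CInfReal Q) :
    Continuous fun q : (f.finite ∩ g.finite : Set Q) => f.val q :=
  continuousOn_iff_continuous_domRestrict.mp (f.continuousOn_val.mono inter_subset_left)

theorem continuous_val_right (f g : CInfReal Q) :
    Continuous fun q : (f.finite ∩ g.finite : Set Q) => g.val q :=
  continuousOn_iff_continuous_domRestrict.mp (g.continuousOn_val.mono inter_subset_right)

instance : Zero (CInfReal Q) := ⟨const 0⟩

instance : One (CInfReal Q) := ⟨const 1⟩

section Extension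

variable [ExtremallyDisconnected Q]

/-- In an extremally disconnected space, a continuous function on a dense subset with values in
`[-∞, +∞]` has a limit at each point. -/
theorem exists_tendsto {D : Set Q} (hD : Dense D) {f : D → EReal} (hf : Continuous f) (q : Q) :
    ∃ c, Tendsto f (comap ((↑) : D → Q) (𝓝 q)) (𝓝 c) := by
  have : (comap ((↑) : D → Q) (𝓝 q)).NeBot := hD.isDenseInducing_val.comap_nhds_neBot q
  refine tendsto_of_no_upcrossings (u := f) dense_univ ?_
  rintro a - b - hab ⟨h1, h2⟩
  obtain ⟨U, hU, hUe⟩ := isOpen_induced_iff.mp (isOpen_Iio.preimage hf : IsOpen (f ⁻¹' Iio a))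
  obtain ⟨V, hV, hVe⟩ := isOpen_induced_iff.mp (isOpen_Ioi.preimage hf : IsOpen (f ⁻¹' Ioi b))
  have hdisj : Disjoint U V := by
    rw [Set.disjoint_iff_inter_eq_empty]
    by_contra hne
    obtain ⟨x, hx, hxD⟩ :=
      hD.inter_open_nonempty _ (hU.inter hV) (nonempty_iff_ne_empty.mpr hne)
    have ha : f ⟨x, hxD⟩ < a := by
      have : (⟨x, hxD⟩ : D) ∈ f ⁻¹' Iio a := hUe ▸ (show (⟨x, hxD⟩ : D) ∈ Subtype.val ⁻¹' U from hx.1)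
      exact this
    have hb : b < f ⟨x, hxD⟩ := by
      have : (⟨x, hxD⟩ : D) ∈ f ⁻¹' Ioi b := hVe ▸ (show (⟨x, hxD⟩ : D) ∈ Subtype.val ⁻¹' V from hx.2)
      exact this
    exact absurd (ha.trans (hab.trans hb)) (lt_irrefl _)
  have hcl : Disjoint (closure U) (closure V) :=
    ExtremallyDisconnected.disjoint_closure_of_disjoint_isOpen hdisj hU hV
  have key : ∀ (W : Set Q) (P : D → Prop), (∃ᶠ x in comap ((↑) : D → Q) (𝓝 q), P x) →
      (∀ x, P x → (x : Q) ∈ W) → q ∈ closure W := by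
    intro W P hP hW
    rw [mem_closure_iff_frequently]
    rw [frequently_comap] at hP
    exact hP.mono (by rintro x ⟨y, rfl, hy⟩; exact hW y hy)
  refine Set.disjoint_left.mp hcl (key U _ h1 fun x hx => ?_) (key V _ h2 fun x hx => ?_)
  · have : x ∈ Subtype.val ⁻¹' U := hUe ▸ (show x ∈ f ⁻¹' Iio a from hx)
    exact this
  · have : x ∈ Subtype.val ⁻¹' V := hVe ▸ (show x ∈ f ⁻¹' Ioi b from hx)
    exact this

theorem extend_continuous {D : Set Q} (hD : Dense D) {f : D → EReal} (hf : Continuous f) :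
    Continuous (hD.isDenseInducing_val.extend f) :=
  hD.isDenseInducing_val.continuous_extend (exists_tendsto hD hf)

/-- The unique element of `C_∞(Q, ℝ)` that extends a given real-valued continuous function on a
dense subset of the extremally disconnected space `Q`. -/
noncomputable def extend (D : Set Q) (hD : Dense D) (f : D → ℝ) (hf : Continuous f) :
    CInfReal Q where
  toFun := hD.isDenseInducing_val.extend fun q => (f q : EReal)
  continuous_toFun := extend_continuous hD (continuous_coe_real_ereal.comp hf)
  nowhereDense_infinite := by
    have hc := extend_continuous hD (continuous_coe_real_ereal.comp hf)
    have hcl : IsClosed {q | hD.isDenseInducing_val.extend (fun q => (f q : EReal)) q = ⊤ ∨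
        hD.isDenseInducing_val.extend (fun q => (f q : EReal)) q = ⊥} :=
      (isClosed_singleton.preimage hc).union (isClosed_singleton.preimage hc)
    rw [hcl.isNowhereDense_iff, interior_eq_empty_iff_dense_compl]
    refine hD.mono fun q hq h => ?_
    have : hD.isDenseInducing_val.extend (fun q => (f q : EReal)) q = (f ⟨q, hq⟩ : EReal) :=
      hD.isDenseInducing_val.extend_eq (continuous_coe_real_ereal.comp hf) ⟨q, hq⟩
    simp [this] at h

theorem extend_apply {D : Set Q} (hD : Dense D) {f : D → ℝ} (hf : Continuous f) (q : D) :
    (extend D hD f hf).toFun q = f q :=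
  hD.isDenseInducing_val.extend_eq (continuous_coe_real_ereal.comp hf) q

/-- The sum is the extension of the pointwise sum from the set where both terms are finite. -/
noncomputable instance : Add (CInfReal Q) :=
  ⟨fun f g => extend _ (dense_finite_inter f g) (fun q => f.val q + g.val q)
    ((continuous_val_left f g).add (continuous_val_right f g))⟩

/-- The product is the extension of the pointwise product from the set where both factors are
finite. -/
noncomputable instance : Mul (CInfReal Q) :=
  ⟨fun f g => extend _ (dense_finite_inter f g) (fun q => f.val q * g.val q)
    ((continuous_val_left f g).mul (continuous_val_right f g))⟩

noncomputable instance : Neg (CInfReal Q) :=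
  ⟨fun f => extend f.finite f.dense_finite (fun q => -f.val q)
    (continuousOn_iff_continuous_domRestrict.mp f.continuousOn_val).neg⟩

/-- Multiplication by a real number, identified with a constant function. -/
noncomputable instance : SMul ℝ (CInfReal Q) := ⟨fun c f => const c * f⟩

end Extension

end CInfReal

/-- `C_∞(Q, ℂ)`, the complexification `C_∞(Q, ℝ) ∔ i C_∞(Q, ℝ)`. -/
@[ext]
structure CInfComplex (Q : Type u) [TopologicalSpace Q] : Type u where
  re : CInfReal Q
  im : CInfReal Q

namespace CInfComplex

variable {Q : Type u} [TopologicalSpace Q]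

/-- The set of points at which `f` is finite. -/
def finite (f : CInfComplex Q) : Set Q := f.re.finite ∩ f.im.finite

/-- The complex value of `f`; it is meaningful on `f.finite`. -/
noncomputable def val (f : CInfComplex Q) (q : Q) : ℂ := ⟨f.re.val q, f.im.val q⟩

theorem finite_mem_residual (f : CInfComplex Q) : f.finite ∈ residual Q :=
  inter_mem f.re.finite_mem_residual f.im.finite_mem_residual

theorem continuous_val (f : CInfComplex Q) : Continuous fun q : f.finite => f.val q := by
  have h := (Complex.continuous_ofReal.comp (CInfReal.continuous_val_left f.re f.im)).add
    ((Complex.continuous_ofReal.comp (CInfReal.continuous_val_right f.re f.im)).mul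
      (continuous_const (y := Complex.I)))
  exact h.congr fun q => (Complex.mk_eq_add_mul_I _ _).symm

variable [ExtremallyDisconnected Q]

/-- The constant functions. -/
def const (c : ℂ) : CInfComplex Q := ⟨CInfReal.const c.re, CInfReal.const c.im⟩

instance : One (CInfComplex Q) := ⟨⟨1, 0⟩⟩

noncomputable instance : Add (CInfComplex Q) := ⟨fun f g => ⟨f.re + g.re, f.im + g.im⟩⟩

noncomputable instance : Mul (CInfComplex Q) :=
  ⟨fun f g => ⟨f.re * g.re + -(f.im * g.im), f.re * g.im + f.im * g.re⟩⟩

/-- Complex conjugation. -/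
noncomputable def conj (f : CInfComplex Q) : CInfComplex Q := ⟨f.re, -f.im⟩

/-- The modulus: the extension of `q ↦ |f(q)|` from the set where `f` is finite. -/
noncomputable def modulus (f : CInfComplex Q) : CInfReal Q :=
  CInfReal.extend f.finite (CInfReal.dense_finite_inter f.re f.im) (fun q => ‖f.val q‖)
    f.continuous_val.norm

end CInfComplex

/-! ### Banach–Kantorovich spaces and C⋆-algebras over `C_∞(Q, ℂ)` -/

/-- The operations make `A` a complex ⋆-algebra (not necessarily unital). -/
structure IsComplexStarAlgebra (A : Type v) [Zero A] [Add A] [Neg A] [SMul ℂ A] [Mul A] [Star A] :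
    Prop where
  add_assoc : ∀ x y z : A, x + y + z = x + (y + z)
  add_comm : ∀ x y : A, x + y = y + x
  add_zero : ∀ x : A, x + 0 = x
  add_neg : ∀ x : A, x + -x = 0
  one_smul : ∀ x : A, (1 : ℂ) • x = x
  mul_smul : ∀ (a b : ℂ) (x : A), (a * b) • x = a • b • x
  smul_add : ∀ (a : ℂ) (x y : A), a • (x + y) = a • x + a • y
  add_smul : ∀ (a b : ℂ) (x : A), (a + b) • x = a • x + b • x
  mul_assoc : ∀ x y z : A, x * y * z = x * (y * z)
  mul_add : ∀ x y z : A, x * (y + z) = x * y + x * z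
  add_mul : ∀ x y z : A, (x + y) * z = x * z + y * z
  smul_mul : ∀ (a : ℂ) (x y : A), (a • x) * y = a • (x * y)
  mul_smul_comm : ∀ (a : ℂ) (x y : A), x * (a • y) = a • (x * y)
  star_star : ∀ x : A, star (star x) = x
  star_add : ∀ x y : A, star (x + y) = star x + star y
  star_smul : ∀ (a : ℂ) (x : A), star (a • x) = (starRingEnd ℂ a) • star x
  star_mul : ∀ x y : A, star (x * y) = star y * star x

section Norms

variable {Q : Type u} [TopologicalSpace Q] [ExtremallyDisconnected Q]
variable {X : Type v} [Zero X] [Add X] [Neg X] [SMul ℂ X]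

/-- `p` is a vector norm with values in the positive cone of `C_∞(Q, ℝ)`. -/
structure IsVectorNorm (p : X → CInfReal Q) : Prop where
  nonneg : ∀ x, 0 ≤ p x
  eq_zero_iff : ∀ x, p x = 0 ↔ x = 0
  smul : ∀ (a : ℂ) (x : X), p (a • x) = ‖a‖ • p x
  add_le : ∀ x y, p (x + y) ≤ p x + p y

/-- `p` is a decomposable (Kantorovich) norm. -/
def IsDecomposable (p : X → CInfReal Q) : Prop :=
  ∀ (e₁ e₂ : CInfReal Q) (x : X), 0 ≤ e₁ → 0 ≤ e₂ → p x = e₁ + e₂ →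
    ∃ x₁ x₂ : X, x = x₁ + x₂ ∧ p x₁ = e₁ ∧ p x₂ = e₂

/-- The net `x` is `bo`-convergent to `y`. -/
def BoConverges (p : X → CInfReal Q) {A : Type w} [Preorder A] (x : A → X) (y : X) : Prop :=
  ∃ (Γ : Type u) (_ : Preorder Γ) (_ : IsDirectedOrder Γ) (_ : Nonempty Γ) (e : Γ → CInfReal Q),
    Antitone e ∧ IsGLB (range e) 0 ∧ ∀ γ, ∃ α₀, ∀ α, α₀ ≤ α → p (y + -x α) ≤ e γ

/-- The net `x` is `bo`-fundamental. -/
def BoFundamental (p : X → CInfReal Q) {A : Type w} [Preorder A] (x : A → X) : Prop :=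
  BoConverges p (fun ab : A × A => x ab.1 + -x ab.2) 0

/-- Every `bo`-fundamental net (indexed in the universe `w`) is `bo`-convergent. -/
def IsBoComplete (p : X → CInfReal Q) : Prop :=
  ∀ (A : Type w) [Preorder A] [IsDirectedOrder A] [Nonempty A] (x : A → X),
    BoFundamental p x → ∃ y, BoConverges p x y

/-- `p` turns `X` into a Banach–Kantorovich space: a decomposable `bo`-complete lattice-normed
space. -/
structure IsBanachKantorovich (p : X → CInfReal Q) : Prop where
  isVectorNorm : IsVectorNorm p
  isDecomposable : IsDecomposable p
  isBoComplete : IsBoComplete.{u, v, w} p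

end Norms

/-- With the given operations and the norm `p`, `A` is a C⋆-algebra over `C_∞(Q, ℂ)`. -/
structure IsCStarAlgebraOver (Q : Type u) [TopologicalSpace Q] [ExtremallyDisconnected Q]
    (A : Type v) [Zero A] [Add A] [Neg A] [SMul ℂ A] [Mul A] [Star A] [SMul (CInfComplex Q) A]
    (p : A → CInfReal Q) : Prop where
  isComplexStarAlgebra : IsComplexStarAlgebra A
  one_smul : ∀ x : A, (1 : CInfComplex Q) • x = x
  mul_smul : ∀ (f g : CInfComplex Q) (x : A), (f * g) • x = f • g • x
  smul_add : ∀ (f : CInfComplex Q) (x y : A), f • (x + y) = f • x + f • y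
  add_smul : ∀ (f g : CInfComplex Q) (x : A), (f + g) • x = f • x + g • x
  const_smul : ∀ (c : ℂ) (x : A), CInfComplex.const (Q := Q) c • x = c • x
  star_smul : ∀ (f : CInfComplex Q) (x : A), star (f • x) = f.conj • star x
  smul_mul : ∀ (f : CInfComplex Q) (x y : A), (f • x) * y = f • (x * y)
  mul_smul_comm : ∀ (f : CInfComplex Q) (x y : A), f • (x * y) = x * (f • y)
  isBanachKantorovich : IsBanachKantorovich.{u, v, w} p
  norm_smul : ∀ (f : CInfComplex Q) (x : A), p (f • x) = f.modulus * p x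
  norm_mul_le : ∀ x y : A, p (x * y) ≤ p x * p y
  norm_star : ∀ x : A, p (star x) = p x
  norm_star_mul_self : ∀ x : A, p (star x * x) = p x * p x

/-! ### Continuous bundles -/

/-- A continuous structure in the family `𝔛` of Banach spaces, which makes it a continuous Banach
bundle over `Q`. -/
structure ContinuousBanachBundle {Q : Type u} [TopologicalSpace Q] (𝔛 : Q → Type v)
    [∀ q, NormedAddCommGroup (𝔛 q)] [∀ q, NormedSpace ℂ (𝔛 q)] [∀ q, CompleteSpace (𝔛 q)] where
  C : Submodule ℂ (∀ q, 𝔛 q)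
  continuous_norm : ∀ s ∈ C, Continuous fun q => ‖s q‖
  dense : ∀ q, Dense {x : 𝔛 q | ∃ s ∈ C, s q = x}

/-- A continuous structure that is stable under products and involution, which makes the family
`𝔛` a continuous bundle of C⋆-algebras over `Q`. -/
structure ContinuousCStarBundle {Q : Type u} [TopologicalSpace Q] (𝔛 : Q → Type v)
    [∀ q, NonUnitalCStarAlgebra (𝔛 q)] extends ContinuousBanachBundle 𝔛 where
  mul_mem : ∀ s ∈ C, ∀ t ∈ C, s * t ∈ C
  star_mem : ∀ s ∈ C, star s ∈ C

namespace ContinuousBanachBundle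

variable {Q : Type u} [TopologicalSpace Q] {𝔛 : Q → Type v}
  [∀ q, NormedAddCommGroup (𝔛 q)] [∀ q, NormedSpace ℂ (𝔛 q)] [∀ q, CompleteSpace (𝔛 q)]

/-- The total space of the bundle. -/
structure Total (B : ContinuousBanachBundle 𝔛) where
  base : Q
  point : 𝔛 base

/-- The tube of radius `ε` around the restriction of the section `s` to `V`. -/
def tube (B : ContinuousBanachBundle 𝔛) (s : ∀ q, 𝔛 q) (V : Set Q) (ε : ℝ) : Set B.Total :=
  {x | x.base ∈ V ∧ ‖x.point - s x.base‖ < ε}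

/-- The topology of the total space, generated by the tubes around the restrictions of the sections
in `B.C` to open sets. -/
instance (B : ContinuousBanachBundle 𝔛) : TopologicalSpace B.Total :=
  TopologicalSpace.generateFrom
    {U | ∃ s ∈ B.C, ∃ V : Set Q, IsOpen V ∧ ∃ ε : ℝ, 0 < ε ∧ U = B.tube s V ε}

/-- The section `u` over `D` is continuous, as a map into the total space. -/
def IsContinuousSection (B : ContinuousBanachBundle 𝔛) {D : Set Q} (u : ∀ q : D, 𝔛 q) : Prop :=
  Continuous fun q : D => (⟨q, u q⟩ : B.Total)

variable {B : ContinuousBanachBundle 𝔛} {D : Set Q}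

/-- A section is continuous if and only if it is locally approximable by sections in `B.C`. -/
theorem isContinuousSection_iff {u : ∀ q : D, 𝔛 q} :
    B.IsContinuousSection u ↔
      ∀ q₀ : D, ∀ ε > 0, ∃ s ∈ B.C, ∀ᶠ q : D in 𝓝 q₀, ‖u q - s q‖ < ε := by
  constructor
  · intro h q₀ ε hε
    obtain ⟨_, ⟨s, hs, rfl⟩, hx⟩ := (B.dense q₀).exists_dist_lt (u q₀) hε
    refine ⟨s, hs, ?_⟩
    have ho : IsOpen (B.tube s univ ε) :=
      TopologicalSpace.isOpen_generateFrom_of_mem ⟨s, hs, univ, isOpen_univ, ε, hε, rfl⟩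
    have hm := (ho.preimage h).mem_nhds
      (show q₀ ∈ _ from ⟨mem_univ _, by rwa [dist_eq_norm] at hx⟩)
    filter_upwards [hm] with q hq using hq.2
  · intro h
    refine continuous_generateFrom_iff.mpr ?_
    rintro _ ⟨s, hs, V, hV, ε, -, rfl⟩
    rw [isOpen_iff_mem_nhds]
    rintro q₀ ⟨hq₀, hlt⟩
    replace hlt : ‖u q₀ - s q₀‖ < ε := hlt
    obtain ⟨t, ht, hev⟩ := h q₀ ((ε - ‖u q₀ - s q₀‖) / 4) (by linarith)
    have hc : Continuous fun q : D => ‖(t - s) q‖ :=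
      (B.continuous_norm _ (B.C.sub_mem ht hs)).comp continuous_subtype_val
    have h0 : ‖(t - s) q₀‖ < ‖u q₀ - s q₀‖ + (ε - ‖u q₀ - s q₀‖) / 2 := by
      have h1 := hev.self_of_nhds
      have h2 : ‖(t - s) q₀‖ ≤ ‖u q₀ - s q₀‖ + ‖u q₀ - t q₀‖ := by
        have : (t - s) q₀ = (u q₀ - s q₀) - (u q₀ - t q₀) := by simp
        rw [this]
        exact norm_sub_le _ _
      linarith
    filter_upwards [hev, hc.continuousAt.eventually (gt_mem_nhds h0),
      (hV.preimage continuous_subtype_val).mem_nhds hq₀] with q h1 h2 h3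
    refine ⟨h3, ?_⟩
    have h4 : ‖u q - s q‖ ≤ ‖u q - t q‖ + ‖(t - s) q‖ := by
      have : u q - s q = (u q - t q) + (t - s) q := by simp
      rw [this]
      exact norm_add_le _ _
    change ‖u q - s q‖ < ε
    linarith

theorem IsContinuousSection.mono {D' : Set Q} {u : ∀ q : D, 𝔛 q} (hu : B.IsContinuousSection u)
    (h : D' ⊆ D) : B.IsContinuousSection fun q : D' => u ⟨q, h q.2⟩ :=
  Continuous.comp hu (continuous_inclusion h)

theorem IsContinuousSection.norm {u : ∀ q : D, 𝔛 q} (hu : B.IsContinuousSection u) :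
    Continuous fun q => ‖u q‖ := by
  rw [isContinuousSection_iff] at hu
  rw [continuous_iff_continuousAt]
  intro q₀
  rw [ContinuousAt, Metric.tendsto_nhds]
  intro ε hε
  obtain ⟨s, hs, hev⟩ := hu q₀ (ε / 3) (by positivity)
  have hc : Continuous fun q : D => ‖s q‖ :=
    (B.continuous_norm _ hs).comp continuous_subtype_val
  filter_upwards [hev, Metric.tendsto_nhds.mp hc.continuousAt (ε / 3) (by positivity)] with q h1 h2
  have h0 := hev.self_of_nhds
  rw [Real.dist_eq] at h2 ⊢
  have a1 := abs_norm_sub_norm_le (u q) (s q)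
  have a2 := abs_norm_sub_norm_le (u q₀) (s q₀)
  rw [abs_lt] at *
  rw [abs_le] at a1 a2
  constructor <;> linarith [h2.1, h2.2, a1.1, a1.2, a2.1, a2.2]

theorem IsContinuousSection.add {u v : ∀ q : D, 𝔛 q} (hu : B.IsContinuousSection u)
    (hv : B.IsContinuousSection v) : B.IsContinuousSection fun q => u q + v q := by
  rw [isContinuousSection_iff] at *
  intro q₀ ε hε
  obtain ⟨s, hs, h1⟩ := hu q₀ (ε / 2) (by positivity)
  obtain ⟨t, ht, h2⟩ := hv q₀ (ε / 2) (by positivity)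
  refine ⟨s + t, B.C.add_mem hs ht, ?_⟩
  filter_upwards [h1, h2] with q h1 h2
  have : u q + v q - (s + t) q = (u q - s q) + (v q - t q) := by
    simp only [Pi.add_apply]; abel
  rw [this]
  linarith [norm_add_le (u q - s q) (v q - t q)]

theorem IsContinuousSection.smul {f : D → ℂ} (hf : Continuous f) {u : ∀ q : D, 𝔛 q}
    (hu : B.IsContinuousSection u) : B.IsContinuousSection fun q => f q • u q := by
  have hn := hu.norm
  rw [isContinuousSection_iff] at *
  intro q₀ ε hε
  obtain ⟨s, hs, h1⟩ := hu q₀ (ε / 2 / (‖f q₀‖ + 1)) (by positivity)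
  refine ⟨f q₀ • s, B.C.smul_mem _ hs, ?_⟩
  have hlim : Tendsto (fun q => ‖f q - f q₀‖ * ‖u q‖) (𝓝 q₀) (𝓝 (‖f q₀ - f q₀‖ * ‖u q₀‖)) :=
    ((hf.sub continuous_const).norm.mul hn).continuousAt
  rw [sub_self, norm_zero, zero_mul] at hlim
  filter_upwards [h1, hlim.eventually (gt_mem_nhds (half_pos hε))] with q h1 h2
  have e : f q • u q - (f q₀ • s) q = (f q - f q₀) • u q + f q₀ • (u q - s q) := by
    simp only [Pi.smul_apply, sub_smul, smul_sub]; abel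
  rw [e]
  have h3 : ‖f q₀‖ * ‖u q - s q‖ ≤ ε / 2 := by
    rw [lt_div_iff₀ (by positivity)] at h1
    nlinarith [norm_nonneg (u q - s q)]
  have h4 := norm_add_le ((f q - f q₀) • u q) (f q₀ • (u q - s q))
  rw [norm_smul, norm_smul] at h4
  linarith

theorem IsContinuousSection.neg {u : ∀ q : D, 𝔛 q} (hu : B.IsContinuousSection u) :
    B.IsContinuousSection fun q => -u q := by
  simpa using hu.smul (continuous_const (y := (-1 : ℂ)))

end ContinuousBanachBundle

namespace ContinuousCStarBundle

variable {Q : Type u} [TopologicalSpace Q] {𝔛 : Q → Type v} [∀ q, NonUnitalCStarAlgebra (𝔛 q)]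

open ContinuousBanachBundle

theorem isContinuousSection_mul {B : ContinuousCStarBundle 𝔛} {D : Set Q} {u v : ∀ q : D, 𝔛 q}
    (hu : B.IsContinuousSection u) (hv : B.IsContinuousSection v) :
    B.IsContinuousSection fun q => u q * v q := by
  have hn := hv.norm
  rw [isContinuousSection_iff] at *
  intro q₀ ε hε
  obtain ⟨s, hs, h1⟩ := hu q₀ (ε / 2 / (‖v q₀‖ + 1)) (by positivity)
  have hc : Continuous fun q : D => ‖s q‖ :=
    (B.continuous_norm _ hs).comp continuous_subtype_val
  obtain ⟨t, ht, h2⟩ := hv q₀ (ε / 2 / (‖s q₀‖ + 1)) (by positivity)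
  refine ⟨s * t, B.mul_mem s hs t ht, ?_⟩
  filter_upwards [h1, h2, hn.continuousAt.eventually (gt_mem_nhds (lt_add_one ‖v q₀‖)),
    hc.continuousAt.eventually (gt_mem_nhds (lt_add_one ‖s q₀‖))] with q h1 h2 h3 h4
  have e : u q * v q - (s * t) q = (u q - s q) * v q + s q * (v q - t q) := by
    simp only [Pi.mul_apply, sub_mul, mul_sub]; abel
  rw [e]
  rw [lt_div_iff₀ (by positivity)] at h1 h2
  have a1 := norm_mul_le (u q - s q) (v q)
  have a2 := norm_mul_le (s q) (v q - t q)
  have a3 := norm_add_le ((u q - s q) * v q) (s q * (v q - t q))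
  have a4 := mul_le_mul_of_nonneg_left h3.le (norm_nonneg (u q - s q))
  have a5 := mul_le_mul_of_nonneg_left h4.le (norm_nonneg (v q - t q))
  linarith [mul_comm ‖s q‖ ‖v q - t q‖]

theorem isContinuousSection_star {B : ContinuousCStarBundle 𝔛} {D : Set Q} {u : ∀ q : D, 𝔛 q}
    (hu : B.IsContinuousSection u) : B.IsContinuousSection fun q => star (u q) := by
  rw [isContinuousSection_iff] at *
  intro q₀ ε hε
  obtain ⟨s, hs, h1⟩ := hu q₀ ε hε
  refine ⟨star s, B.star_mem s hs, ?_⟩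
  filter_upwards [h1] with q h1
  have e : star (u q) - (star s) q = star (u q - s q) := by simp
  rwa [e, norm_star]

end ContinuousCStarBundle

/-! ### Classes of almost global sections -/

/-- An almost global section: a continuous section over a comeager set. -/
structure AlmostGlobalSection {Q : Type u} [TopologicalSpace Q] {𝔛 : Q → Type v}
    [∀ q, NonUnitalCStarAlgebra (𝔛 q)] (B : ContinuousCStarBundle 𝔛) where
  dom : Set Q
  dom_mem : dom ∈ residual Q
  toFun : ∀ q : dom, 𝔛 q
  continuous_toFun : B.IsContinuousSection toFun

namespace AlmostGlobalSection

variable {Q : Type u} [TopologicalSpace Q] {𝔛 : Q → Type v} [∀ q, NonUnitalCStarAlgebra (𝔛 q)]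
  {B : ContinuousCStarBundle 𝔛}

open ContinuousBanachBundle

/-- Two almost global sections are equivalent if they agree wherever both are defined. -/
def Equiv (a b : AlmostGlobalSection B) : Prop :=
  ∀ (q : Q) (ha : q ∈ a.dom) (hb : q ∈ b.dom), a.toFun ⟨q, ha⟩ = b.toFun ⟨q, hb⟩

theorem Equiv.trans [BaireSpace Q] {a b c : AlmostGlobalSection B} (hab : a.Equiv b)
    (hbc : b.Equiv c) : a.Equiv c := by
  intro q₀ ha hc
  have hca := a.continuous_toFun.mono (D' := a.dom ∩ c.dom) inter_subset_left
  have hcc := c.continuous_toFun.mono (D' := a.dom ∩ c.dom) inter_subset_right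
  have hn := (hca.add hcc.neg).norm
  have hd : Dense (b.dom : Set Q) := dense_of_mem_residual b.dom_mem
  have hd' : Dense {q : (a.dom ∩ c.dom : Set Q) | (q : Q) ∈ b.dom} := by
    rw [dense_iff_inter_open]
    rintro W hW ⟨x, hx⟩
    obtain ⟨V, hV, rfl⟩ := isOpen_induced_iff.mp hW
    obtain ⟨y, hyV, hy⟩ := (dense_of_mem_residual (inter_mem (inter_mem a.dom_mem c.dom_mem)
      b.dom_mem)).inter_open_nonempty V hV ⟨x, hx⟩
    exact ⟨⟨y, hy.1⟩, hyV, hy.2⟩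
  have h0 := Continuous.ext_on hd' hn (continuous_const (y := (0 : ℝ))) (by
    intro q hq
    have : a.toFun ⟨q, q.2.1⟩ = c.toFun ⟨q, q.2.2⟩ :=
      (hab q q.2.1 hq).trans (hbc q hq q.2.2)
    simp [this])
  have := congrFun h0 ⟨q₀, ha, hc⟩
  rw [norm_eq_zero, add_neg_eq_zero] at this
  exact this

variable (B) in
instance setoid [BaireSpace Q] : Setoid (AlmostGlobalSection B) where
  r := Equiv
  iseqv := ⟨fun _ _ _ _ => rfl, fun h q ha hb => (h q hb ha).symm, Equiv.trans⟩

/-- The zero section. -/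
def zero : AlmostGlobalSection B where
  dom := univ
  dom_mem := univ_mem
  toFun := fun _ => 0
  continuous_toFun := isContinuousSection_iff.mpr fun _ ε hε =>
    ⟨0, B.C.zero_mem, Eventually.of_forall fun _ => by simpa using hε⟩

/-- The pointwise sum. -/
def add (a b : AlmostGlobalSection B) : AlmostGlobalSection B where
  dom := a.dom ∩ b.dom
  dom_mem := inter_mem a.dom_mem b.dom_mem
  toFun := fun q => a.toFun ⟨q, q.2.1⟩ + b.toFun ⟨q, q.2.2⟩
  continuous_toFun := (a.continuous_toFun.mono inter_subset_left).add
    (b.continuous_toFun.mono inter_subset_right)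

/-- The pointwise product. -/
def mul (a b : AlmostGlobalSection B) : AlmostGlobalSection B where
  dom := a.dom ∩ b.dom
  dom_mem := inter_mem a.dom_mem b.dom_mem
  toFun := fun q => a.toFun ⟨q, q.2.1⟩ * b.toFun ⟨q, q.2.2⟩
  continuous_toFun := ContinuousCStarBundle.isContinuousSection_mul
    (a.continuous_toFun.mono inter_subset_left) (b.continuous_toFun.mono inter_subset_right)

/-- The pointwise opposite. -/
def neg (a : AlmostGlobalSection B) : AlmostGlobalSection B where
  dom := a.dom
  dom_mem := a.dom_mem
  toFun := fun q => -a.toFun q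
  continuous_toFun := a.continuous_toFun.neg

/-- The pointwise involution. -/
def star (a : AlmostGlobalSection B) : AlmostGlobalSection B where
  dom := a.dom
  dom_mem := a.dom_mem
  toFun := fun q => Star.star (a.toFun q)
  continuous_toFun := ContinuousCStarBundle.isContinuousSection_star a.continuous_toFun

/-- The pointwise product with a complex number. -/
def smul (c : ℂ) (a : AlmostGlobalSection B) : AlmostGlobalSection B where
  dom := a.dom
  dom_mem := a.dom_mem
  toFun := fun q => c • a.toFun q
  continuous_toFun := a.continuous_toFun.smul continuous_const

/-- The pointwise product with an extended function, on the set where that function is finite. -/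
noncomputable def fsmul [ExtremallyDisconnected Q] (f : CInfComplex Q)
    (a : AlmostGlobalSection B) : AlmostGlobalSection B where
  dom := f.finite ∩ a.dom
  dom_mem := inter_mem f.finite_mem_residual a.dom_mem
  toFun := fun q => f.val q • a.toFun ⟨q, q.2.2⟩
  continuous_toFun := (a.continuous_toFun.mono inter_subset_right).smul
    (f.continuous_val.comp (continuous_inclusion inter_subset_left))

/-- The extension to `Q` of the pointwise norm `q ↦ ‖a(q)‖` of an almost global section. -/
noncomputable def norm [BaireSpace Q] [ExtremallyDisconnected Q] (a : AlmostGlobalSection B) :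
    CInfReal Q :=
  CInfReal.extend a.dom (dense_of_mem_residual a.dom_mem) (fun q => ‖a.toFun q‖)
    a.continuous_toFun.norm

theorem norm_congr [BaireSpace Q] [ExtremallyDisconnected Q] {a b : AlmostGlobalSection B}
    (h : a.Equiv b) : a.norm = b.norm := by
  refine CInfReal.eq_of_dense
    (dense_of_mem_residual (inter_mem a.dom_mem b.dom_mem)) fun q hq => ?_
  have h1 : a.norm.toFun q = _ := CInfReal.extend_apply _ a.continuous_toFun.norm ⟨q, hq.1⟩
  have h2 : b.norm.toFun q = _ := CInfReal.extend_apply _ b.continuous_toFun.norm ⟨q, hq.2⟩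
  rw [h1, h2, h q hq.1 hq.2]

end AlmostGlobalSection

/-- `C_∞(Q, 𝔛)`: the almost global sections, up to equality on common domains. -/
def CInfSections {Q : Type u} [TopologicalSpace Q] [BaireSpace Q] {𝔛 : Q → Type v}
    [∀ q, NonUnitalCStarAlgebra (𝔛 q)] (B : ContinuousCStarBundle 𝔛) : Type (max u v) :=
  Quotient (AlmostGlobalSection.setoid B)

namespace CInfSections

variable {Q : Type u} [TopologicalSpace Q] [BaireSpace Q] {𝔛 : Q → Type v}
  [∀ q, NonUnitalCStarAlgebra (𝔛 q)] {B : ContinuousCStarBundle 𝔛}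

instance : Zero (CInfSections B) := ⟨Quotient.mk _ AlmostGlobalSection.zero⟩

instance : Add (CInfSections B) :=
  ⟨Quotient.map₂ AlmostGlobalSection.add fun _ _ h _ _ h' q hq hq' =>
    congrArg₂ (· + ·) (h q hq.1 hq'.1) (h' q hq.2 hq'.2)⟩

instance : Mul (CInfSections B) :=
  ⟨Quotient.map₂ AlmostGlobalSection.mul fun _ _ h _ _ h' q hq hq' =>
    congrArg₂ (· * ·) (h q hq.1 hq'.1) (h' q hq.2 hq'.2)⟩

instance : Neg (CInfSections B) :=
  ⟨Quotient.map AlmostGlobalSection.neg fun _ _ h q hq hq' => congrArg (- ·) (h q hq hq')⟩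

instance : Star (CInfSections B) :=
  ⟨Quotient.map AlmostGlobalSection.star fun _ _ h q hq hq' => congrArg Star.star (h q hq hq')⟩

instance : SMul ℂ (CInfSections B) :=
  ⟨fun c => Quotient.map (AlmostGlobalSection.smul c) fun _ _ h q hq hq' =>
    congrArg (c • ·) (h q hq hq')⟩

noncomputable instance [ExtremallyDisconnected Q] : SMul (CInfComplex Q) (CInfSections B) :=
  ⟨fun f => Quotient.map (AlmostGlobalSection.fsmul f) fun _ _ h q hq hq' =>
    congrArg (f.val q • ·) (h q hq.2 hq'.2)⟩

/-- The norm of `C_∞(Q, 𝔛)` with values in `C_∞(Q, ℝ)`. -/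
noncomputable def norm [ExtremallyDisconnected Q] : CInfSections B → CInfReal Q :=
  Quotient.lift AlmostGlobalSection.norm fun _ _ h => AlmostGlobalSection.norm_congr h

end CInfSections

end StoneanBundle

/-! Elements of `CInfReal Q` are continuous maps into `EReal`, so an equality or inequality between
two of them need only be checked on a dense set. Compactness of `Q` gives the Baire property, so the
common domain of countably many almost global sections is comeager, hence dense. The algebraic
axioms and the norm identities therefore follow from the corresponding facts in each fiber.

Decomposability: if `‖u‖ = e₁ + e₂`, take `uᵢ = (eᵢ / ‖u‖) u`. The quotient is continuous off the
boundary of the support of `‖u‖`, which is nowhere dense, and where `u` vanishes both `eᵢ` vanish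
too (`exists_norm_div_smul`).

Completeness: let `e` dominate the tails of the net `a`, say beyond `i γ` for `e γ`. Because `Q` is
extremally disconnected, infimum `0` forces the open sets `{e γ < 1/(n+1)}` to have dense union over
`γ` (`dense_iUnion_lt_of_isGLB_zero`). There may be uncountably many `γ`, so the domains of all `a
(i γ)` cannot be intersected; instead the open sets are made disjoint and the sections glued along
them into one section `s n` (`exists_glue`). The sequence `s n` is uniformly Cauchy, and its
pointwise limit on the countable intersection of domains is a continuous section
(`exists_tendsto_value`), which is the `bo`-limit, with the same `e` as regulator. -/

namespace StoneanBundle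

/-! ### Density principle and evaluation at finite points in `C_∞(Q, ℝ)`. -/

namespace CInfReal

variable {Q : Type u} [TopologicalSpace Q]

theorem le_of_dense {f g : CInfReal Q} {D : Set Q} (hD : Dense D)
    (h : ∀ q ∈ D, f.toFun q ≤ g.toFun q) : f ≤ g := fun q =>
  hD.induction (P := fun q => f.toFun q ≤ g.toFun q) h
    (isClosed_le f.continuous_toFun g.continuous_toFun) q

theorem coe_val {f : CInfReal Q} {q : Q} (hq : q ∈ f.finite) : (f.val q : EReal) = f.toFun q :=
  EReal.coe_toReal hq.1 hq.2

theorem val_eq_of_toFun_eq {f : CInfReal Q} {q : Q} {c : ℝ} (h : f.toFun q = c) :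
    f.val q = c := by simp [val, h]

theorem mem_finite_of_toFun_eq {f : CInfReal Q} {q : Q} {c : ℝ} (h : f.toFun q = c) :
    q ∈ f.finite := by simp [finite, h]

theorem const_toFun (c : ℝ) (q : Q) : (const c : CInfReal Q).toFun q = c := rfl

theorem zero_toFun (q : Q) : (0 : CInfReal Q).toFun q = (0 : ℝ) := rfl

theorem one_toFun (q : Q) : (1 : CInfReal Q).toFun q = (1 : ℝ) := rfl

variable [ExtremallyDisconnected Q]

theorem add_toFun {f g : CInfReal Q} {q : Q} (hf : q ∈ f.finite) (hg : q ∈ g.finite) :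
    (f + g).toFun q = (f.val q + g.val q : ℝ) :=
  extend_apply (dense_finite_inter f g)
    ((continuous_val_left f g).add (continuous_val_right f g)) ⟨q, hf, hg⟩

theorem mul_toFun {f g : CInfReal Q} {q : Q} (hf : q ∈ f.finite) (hg : q ∈ g.finite) :
    (f * g).toFun q = (f.val q * g.val q : ℝ) :=
  extend_apply (dense_finite_inter f g)
    ((continuous_val_left f g).mul (continuous_val_right f g)) ⟨q, hf, hg⟩

theorem neg_toFun {f : CInfReal Q} {q : Q} (hf : q ∈ f.finite) :
    (-f).toFun q = (-f.val q : ℝ) :=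
  extend_apply f.dense_finite
    (continuousOn_iff_continuous_domRestrict.mp f.continuousOn_val).neg ⟨q, hf⟩

/-- A real value at `q` carries finiteness with it, so evaluations in this form compose without side
conditions. -/
theorem add_toFun_of_eq {f g : CInfReal Q} {q : Q} {a b : ℝ} (hf : f.toFun q = a)
    (hg : g.toFun q = b) : (f + g).toFun q = (a + b : ℝ) := by
  rw [add_toFun (mem_finite_of_toFun_eq hf) (mem_finite_of_toFun_eq hg), val_eq_of_toFun_eq hf,
    val_eq_of_toFun_eq hg]

theorem mul_toFun_of_eq {f g : CInfReal Q} {q : Q} {a b : ℝ} (hf : f.toFun q = a)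
    (hg : g.toFun q = b) : (f * g).toFun q = (a * b : ℝ) := by
  rw [mul_toFun (mem_finite_of_toFun_eq hf) (mem_finite_of_toFun_eq hg), val_eq_of_toFun_eq hf,
    val_eq_of_toFun_eq hg]

theorem neg_toFun_of_eq {f : CInfReal Q} {q : Q} {a : ℝ} (hf : f.toFun q = a) :
    (-f).toFun q = (-a : ℝ) := by
  rw [neg_toFun (mem_finite_of_toFun_eq hf), val_eq_of_toFun_eq hf]

/-- A family in `C_∞(Q, ℝ)` with infimum `0` takes arbitrarily small values on a dense set. -/
theorem dense_iUnion_lt_of_isGLB_zero {Γ : Type*} {e : Γ → CInfReal Q} (he : IsGLB (range e) 0)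
    {ε : ℝ} (hε : 0 < ε) : Dense (⋃ γ, {q | (e γ).toFun q < ε}) := by
  rw [dense_iff_inter_open]
  intro O hO ⟨x, hx⟩
  by_contra hne
  have hge : ∀ γ, ∀ q ∈ O, (ε : EReal) ≤ (e γ).toFun q := fun γ q hq => by
    by_contra hlt
    exact hne ⟨q, hq, mem_iUnion.mpr ⟨γ, not_le.mp hlt⟩⟩
  -- Extremal disconnectedness makes the closure of `O` clopen, so `ε` times its indicator is
  -- continuous. It would be a lower bound of the family, yet it is positive at `x`.
  have hcl : IsClopen (closure O) :=
    ⟨isClosed_closure, ExtremallyDisconnected.open_closure O hO⟩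
  let g : CInfReal Q :=
    { toFun := fun q => ((closure O).indicator (fun _ => ε) q : ℝ)
      continuous_toFun := continuous_coe_real_ereal.comp
        (continuous_const.indicator (by simp [hcl.frontier_eq]))
      nowhereDense_infinite := by simp }
  have hg : g ≤ 0 := by
    refine he.2 ?_
    rintro _ ⟨γ, rfl⟩ q
    by_cases hq : q ∈ closure O
    · have : (ε : EReal) ≤ (e γ).toFun q :=
        closure_minimal (hge γ) (isClosed_le continuous_const (e γ).continuous_toFun) hq
      simpa [g, hq] using this
    · have : (0 : CInfReal Q).toFun q ≤ (e γ).toFun q := he.1 (mem_range_self γ) q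
      rw [zero_toFun] at this
      simpa [g, hq] using this
  have := hg x
  change ((closure O).indicator (fun _ => ε) x : ℝ) ≤ (0 : CInfReal Q).toFun x at this
  rw [zero_toFun, indicator_of_mem (subset_closure hx), EReal.coe_le_coe_iff] at this
  linarith

end CInfReal

/-! ### Evaluation at finite points in `C_∞(Q, ℂ)`. -/

namespace CInfComplex

variable {Q : Type u} [TopologicalSpace Q]

open CInfReal

theorem re_toFun {f : CInfComplex Q} {q : Q} (hf : q ∈ f.finite) :
    f.re.toFun q = ((f.val q).re : ℝ) := (coe_val hf.1).symm

theorem im_toFun {f : CInfComplex Q} {q : Q} (hf : q ∈ f.finite) :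
    f.im.toFun q = ((f.val q).im : ℝ) := (coe_val hf.2).symm

theorem val_eq_of_toFun_eq {f : CInfComplex Q} {q : Q} {z : ℂ} (hr : f.re.toFun q = z.re)
    (hi : f.im.toFun q = z.im) : f.val q = z :=
  Complex.ext (CInfReal.val_eq_of_toFun_eq hr) (CInfReal.val_eq_of_toFun_eq hi)

theorem const_val (c : ℂ) (q : Q) : (const c : CInfComplex Q).val q = c :=
  val_eq_of_toFun_eq rfl rfl

theorem one_val (q : Q) : (1 : CInfComplex Q).val q = 1 :=
  val_eq_of_toFun_eq (one_toFun q) (zero_toFun q)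

variable [ExtremallyDisconnected Q]

theorem add_val {f g : CInfComplex Q} {q : Q} (hf : q ∈ f.finite) (hg : q ∈ g.finite) :
    (f + g).val q = f.val q + g.val q :=
  val_eq_of_toFun_eq (add_toFun_of_eq (re_toFun hf) (re_toFun hg))
    (add_toFun_of_eq (im_toFun hf) (im_toFun hg))

theorem mul_val {f g : CInfComplex Q} {q : Q} (hf : q ∈ f.finite) (hg : q ∈ g.finite) :
    (f * g).val q = f.val q * g.val q := by
  refine val_eq_of_toFun_eq ?_ ?_
  · rw [Complex.mul_re, sub_eq_add_neg]
    exact add_toFun_of_eq (mul_toFun_of_eq (re_toFun hf) (re_toFun hg))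
      (neg_toFun_of_eq (mul_toFun_of_eq (im_toFun hf) (im_toFun hg)))
  · rw [Complex.mul_im]
    exact add_toFun_of_eq (mul_toFun_of_eq (re_toFun hf) (im_toFun hg))
      (mul_toFun_of_eq (im_toFun hf) (re_toFun hg))

theorem conj_val {f : CInfComplex Q} {q : Q} (hf : q ∈ f.finite) :
    f.conj.val q = starRingEnd ℂ (f.val q) :=
  val_eq_of_toFun_eq (re_toFun (f := f) hf) (neg_toFun_of_eq (im_toFun (f := f) hf))

theorem modulus_toFun {f : CInfComplex Q} {q : Q} (hf : q ∈ f.finite) :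
    f.modulus.toFun q = (‖f.val q‖ : ℝ) :=
  extend_apply (dense_finite_inter f.re f.im) f.continuous_val.norm ⟨q, hf⟩

end CInfComplex

/-! ### Comeager sets and disjoint families of open sets. -/

section Residual

variable {Q : Type u} [TopologicalSpace Q]

/-- A union of comeager subsets of disjoint open sets with dense union is comeager. -/
theorem iUnion_inter_mem_residual [BaireSpace Q] {ι : Type*} {U D : ι → Set Q}
    (hU : ∀ i, IsOpen (U i))
    (hd : Dense (⋃ i, U i)) (hdisj : Pairwise fun i j => Disjoint (U i) (U j))
    (hD : ∀ i, D i ∈ residual Q) : ⋃ i, U i ∩ D i ∈ residual Q := by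
  choose t ht htG htd using fun i => mem_residual.mp (hD i)
  choose O hO hOe using fun i => isGδ_iff_eq_iInter_nat.mp (htG i)
  -- The index set may be uncountable, so the union over `i` is taken first, at each level `n`; only
  -- countably many open dense sets are then intersected.
  have hmem : ⋂ n, ⋃ i, U i ∩ O i n ∈ residual Q := by
    refine countable_iInter_mem.mpr fun n => residual_of_dense_open
      (isOpen_iUnion fun i => (hU i).inter (hO i n)) ?_
    rw [dense_iff_inter_open]
    intro W hW hne
    obtain ⟨x, hxW, hx⟩ := hd.inter_open_nonempty W hW hne
    obtain ⟨i, hi⟩ := mem_iUnion.mp hx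
    obtain ⟨y, hy, hyt⟩ := (htd i).inter_open_nonempty (W ∩ U i) (hW.inter (hU i)) ⟨x, hxW, hi⟩
    rw [hOe i] at hyt
    exact ⟨y, hy.1, mem_iUnion.mpr ⟨i, hy.2, mem_iInter.mp hyt n⟩⟩
  refine mem_of_superset hmem fun q hq => ?_
  rw [mem_iInter] at hq
  obtain ⟨i, hi, -⟩ := mem_iUnion.mp (hq 0)
  refine mem_iUnion.mpr ⟨i, hi, ht i ?_⟩
  rw [hOe i, mem_iInter]
  intro n
  obtain ⟨j, hj, hj'⟩ := mem_iUnion.mp (hq n)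
  -- By disjointness the index found at level `n` is the one found at level `0`.
  obtain rfl : i = j := by
    by_contra hij
    exact disjoint_left.mp (hdisj hij) hi hj
  exact hj'

/-- A family of open sets can be shrunk to a disjoint one whose union is dense in the original
union. -/
theorem exists_disjoint_open_refinement {ι : Type*} {V : ι → Set Q} (hV : ∀ i, IsOpen (V i))
    (hd : Dense (⋃ i, V i)) : ∃ U : ι → Set Q, (∀ i, IsOpen (U i)) ∧ (∀ i, U i ⊆ V i) ∧
      Dense (⋃ i, U i) ∧ Pairwise fun i j => Disjoint (U i) (U j) := by
  -- Well-order the indices and remove from each set the closure of the union of its predecessors.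
  let r : ι → ι → Prop := WellOrderingRel
  refine ⟨fun i => V i \ closure (⋃ (j) (_ : r j i), V j),
    fun i => (hV i).sdiff isClosed_closure, fun i => sdiff_subset, ?_, ?_⟩
  · rw [dense_iff_inter_open]
    intro W hW hne
    obtain ⟨x, hxW, hx⟩ := hd.inter_open_nonempty W hW hne
    obtain ⟨i₀, hi₀⟩ := mem_iUnion.mp hx
    have hwf : WellFounded r := IsWellFounded.wf
    -- For the least `i` with `V i` meeting `W`, the earlier sets miss `W`; since `W` is open, so
    -- does the closure of their union, and nothing in `W ∩ V i` is removed.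
    obtain ⟨i, ⟨y, hyW, hy⟩, hmin⟩ := hwf.has_min {i | (W ∩ V i).Nonempty} ⟨i₀, x, hxW, hi₀⟩
    refine ⟨y, hyW, mem_iUnion.mpr ⟨i, hy, fun hcl => ?_⟩⟩
    obtain ⟨z, hzW, hz⟩ := mem_closure_iff.mp hcl W hW hyW
    simp only [mem_iUnion] at hz
    obtain ⟨j, hj, hzj⟩ := hz
    exact hmin j ⟨z, hzW, hzj⟩ hj
  · have key : ∀ i j, r j i → Disjoint (V i \ closure (⋃ (j) (_ : r j i), V j))
        (V j \ closure (⋃ (k) (_ : r k j), V k)) := fun i j hji =>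
      disjoint_left.mpr fun q hq hq' => hq.2 (subset_closure (by
        simp only [mem_iUnion]
        exact ⟨j, hji, hq'.1⟩))
    intro i j hij
    rcases trichotomous_of r i j with h | h | h
    · exact (key j i h).symm
    · exact absurd h hij
    · exact key i j h

end Residual

/-! ### Gluing, limits and rescaling of almost global sections. -/

namespace AlmostGlobalSection

variable {Q : Type u} [TopologicalSpace Q] {𝔛 : Q → Type v} [∀ q, NonUnitalCStarAlgebra (𝔛 q)]
  {B : ContinuousCStarBundle 𝔛}

open ContinuousBanachBundle

open Classical in
/-- The extension of an almost global section by zero. -/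
noncomputable def value (a : AlmostGlobalSection B) (q : Q) : 𝔛 q :=
  if h : q ∈ a.dom then a.toFun ⟨q, h⟩ else 0

theorem value_of_mem (a : AlmostGlobalSection B) {q : Q} (h : q ∈ a.dom) :
    a.value q = a.toFun ⟨q, h⟩ := dif_pos h

/-- Phrasing continuity with neighborhoods in `Q` rather than in the subtype allows sections with
different domains to be compared. -/
theorem exists_approx (a : AlmostGlobalSection B) {q₀ : Q} (h : q₀ ∈ a.dom) {ε : ℝ} (hε : 0 < ε) :
    ∃ s ∈ B.C, ∀ᶠ q in 𝓝[a.dom] q₀, ‖a.value q - s q‖ < ε := by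
  obtain ⟨s, hs, hev⟩ := isContinuousSection_iff.mp a.continuous_toFun ⟨q₀, h⟩ ε hε
  refine ⟨s, hs, ?_⟩
  rw [nhdsWithin_eq_map_subtype_coe h, eventually_map]
  filter_upwards [hev] with q hq
  rwa [a.value_of_mem q.2]

/-- A locally approximable family of vectors restricts to an almost global section on a given
comeager set. -/
def ofApprox (D : Set Q) (hD : D ∈ residual Q) (u : ∀ q, 𝔛 q)
    (h : ∀ q₀ ∈ D, ∀ ε : ℝ, 0 < ε → ∃ s ∈ B.C, ∀ᶠ q in 𝓝[D] q₀, ‖u q - s q‖ < ε) :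
    AlmostGlobalSection B where
  dom := D
  dom_mem := hD
  toFun := fun q => u q
  continuous_toFun := isContinuousSection_iff.mpr fun q₀ ε hε => by
    obtain ⟨s, hs, hev⟩ := h q₀ q₀.2 ε hε
    refine ⟨s, hs, ?_⟩
    rwa [nhdsWithin_eq_map_subtype_coe q₀.2, eventually_map] at hev

theorem ofApprox_value {D : Set Q} (hD : D ∈ residual Q) {u : ∀ q, 𝔛 q}
    (h : ∀ q₀ ∈ D, ∀ ε : ℝ, 0 < ε → ∃ s ∈ B.C, ∀ᶠ q in 𝓝[D] q₀, ‖u q - s q‖ < ε) {q : Q}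
    (hq : q ∈ D) : (ofApprox D hD u h).value q = u q :=
  value_of_mem _ (show q ∈ (ofApprox D hD u h).dom from hq)

/-- After the `V i` are shrunk to disjoint open sets, each point involves a single section, so `ι`
may be uncountable although the domains are only comeager. -/
theorem exists_glue [BaireSpace Q] {ι : Type*} {V : ι → Set Q} (hV : ∀ i, IsOpen (V i))
    (hd : Dense (⋃ i, V i)) (a : ι → AlmostGlobalSection B) :
    ∃ s : AlmostGlobalSection B,
      ∀ q ∈ s.dom, ∃ i, q ∈ V i ∧ q ∈ (a i).dom ∧ s.value q = (a i).value q := by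
  classical
  obtain ⟨U, hU, hUV, hUd, hdisj⟩ := exists_disjoint_open_refinement hV hd
  have huniq : ∀ {i j q}, q ∈ U i → q ∈ U j → i = j := fun {i j q} hi hj => by
    by_contra hij
    exact disjoint_left.mp (hdisj hij) hi hj
  let t : ∀ q, 𝔛 q := fun q => if h : ∃ i, q ∈ U i then (a h.choose).value q else 0
  have ht : ∀ {i q}, q ∈ U i → t q = (a i).value q := fun {i q} hi => by
    have h : ∃ i, q ∈ U i := ⟨i, hi⟩
    simp only [t, dif_pos h]
    rw [huniq h.choose_spec hi]
  have happ : ∀ q₀ ∈ ⋃ i, U i ∩ (a i).dom, ∀ ε : ℝ, 0 < ε →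
      ∃ s ∈ B.C, ∀ᶠ q in 𝓝[⋃ i, U i ∩ (a i).dom] q₀, ‖t q - s q‖ < ε := by
    intro q₀ hq₀ ε hε
    obtain ⟨i, hi, hi'⟩ := mem_iUnion.mp hq₀
    -- Near `q₀` the glued section coincides with `a i` and inherits its approximants.
    obtain ⟨s, hs, hev⟩ := (a i).exists_approx hi' hε
    refine ⟨s, hs, ?_⟩
    rw [eventually_nhdsWithin_iff] at hev ⊢
    filter_upwards [hev, (hU i).mem_nhds hi] with q h1 h2 h3
    obtain ⟨j, hj, hj'⟩ := mem_iUnion.mp h3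
    obtain rfl := huniq h2 hj
    rw [ht h2]
    exact h1 hj'
  have hres := iUnion_inter_mem_residual hU hUd hdisj fun i => (a i).dom_mem
  refine ⟨ofApprox _ hres t happ, fun q hq => ?_⟩
  obtain ⟨i, hi, hi'⟩ := mem_iUnion.mp hq
  exact ⟨i, hUV i hi, hi', by rw [ofApprox_value hres happ hq, ht hi]⟩

/-- A uniformly Cauchy sequence of almost global sections has a pointwise limit. -/
theorem exists_tendsto_value {s : ℕ → AlmostGlobalSection B} {b : ℕ → ℝ}
    (hb : Tendsto b atTop (𝓝 0))
    (h : ∀ n m, ∀ q ∈ (s n).dom, q ∈ (s m).dom → ‖(s n).value q - (s m).value q‖ ≤ b n + b m) :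
    ∃ u : AlmostGlobalSection B, u.dom = ⋂ n, (s n).dom ∧
      ∀ q ∈ u.dom, Tendsto (fun n => (s n).value q) atTop (𝓝 (u.value q)) := by
  classical
  have hlim : ∀ q ∈ ⋂ n, (s n).dom, ∃ x, Tendsto (fun n => (s n).value q) atTop (𝓝 x) := by
    intro q hq
    rw [mem_iInter] at hq
    refine cauchySeq_tendsto_of_complete (Metric.cauchySeq_iff.mpr fun ε hε => ?_)
    obtain ⟨N, hN⟩ := eventually_atTop.mp (hb.eventually (gt_mem_nhds (half_pos hε)))
    refine ⟨N, fun n hn m hm => ?_⟩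
    rw [dist_eq_norm]
    linarith [h n m q (hq n) (hq m), hN n hn, hN m hm]
  let u : ∀ q, 𝔛 q := fun q => if hq : q ∈ ⋂ n, (s n).dom then (hlim q hq).choose else 0
  have hu : ∀ q ∈ ⋂ n, (s n).dom, Tendsto (fun n => (s n).value q) atTop (𝓝 (u q)) := by
    intro q hq
    simp only [u, dif_pos hq]
    exact (hlim q hq).choose_spec
  -- Letting `m → ∞` in the Cauchy estimate gives a bound uniform in `q`, so approximants of `s n`
  -- also approximate `u`.
  have hle : ∀ n, ∀ q ∈ ⋂ n, (s n).dom, ‖u q - (s n).value q‖ ≤ b n := by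
    intro n q hq
    have hr : Tendsto (fun m => b m + b n) atTop (𝓝 (b n)) := by
      simpa using hb.add_const (b n)
    refine le_of_tendsto_of_tendsto' ((hu q hq).sub_const _).norm hr fun m => ?_
    rw [mem_iInter] at hq
    exact h m n q (hq m) (hq n)
  have happ : ∀ q₀ ∈ ⋂ n, (s n).dom, ∀ ε : ℝ, 0 < ε →
      ∃ t ∈ B.C, ∀ᶠ q in 𝓝[⋂ n, (s n).dom] q₀, ‖u q - t q‖ < ε := by
    intro q₀ hq₀ ε hε
    obtain ⟨n, hn⟩ := (hb.eventually (gt_mem_nhds (half_pos hε))).exists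
    obtain ⟨t, ht, hev⟩ := (s n).exists_approx (mem_iInter.mp hq₀ n) (half_pos hε)
    refine ⟨t, ht, ?_⟩
    filter_upwards [nhdsWithin_mono q₀ (iInter_subset _ n) hev, self_mem_nhdsWithin] with q h1 h2
    have := norm_sub_le_norm_sub_add_norm_sub (u q) ((s n).value q) (t q)
    linarith [hle n q h2]
  have hres : ⋂ n, (s n).dom ∈ residual Q := countable_iInter_mem.mpr fun n => (s n).dom_mem
  refine ⟨ofApprox _ hres u happ, rfl, fun q hq => ?_⟩
  rw [ofApprox_value hres happ hq]
  exact hu q hq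

theorem norm_toFun [BaireSpace Q] [ExtremallyDisconnected Q] (a : AlmostGlobalSection B) {q : Q}
    (hq : q ∈ a.dom) : a.norm.toFun q = (‖a.value q‖ : ℝ) := by
  rw [a.value_of_mem hq]
  exact CInfReal.extend_apply (dense_of_mem_residual a.dom_mem) a.continuous_toFun.norm ⟨q, hq⟩

theorem add_value (a b : AlmostGlobalSection B) {q : Q} (ha : q ∈ a.dom) (hb : q ∈ b.dom) :
    (a.add b).value q = a.value q + b.value q := by
  rw [value_of_mem _ ha, value_of_mem _ hb, value_of_mem _ (show q ∈ (a.add b).dom from ⟨ha, hb⟩)]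
  rfl

theorem mul_value (a b : AlmostGlobalSection B) {q : Q} (ha : q ∈ a.dom) (hb : q ∈ b.dom) :
    (a.mul b).value q = a.value q * b.value q := by
  rw [value_of_mem _ ha, value_of_mem _ hb, value_of_mem _ (show q ∈ (a.mul b).dom from ⟨ha, hb⟩)]
  rfl

theorem neg_value (a : AlmostGlobalSection B) {q : Q} (ha : q ∈ a.dom) :
    a.neg.value q = -a.value q := by
  rw [value_of_mem _ ha, value_of_mem _ (show q ∈ a.neg.dom from ha)]
  rfl

theorem sub_value (a b : AlmostGlobalSection B) {q : Q} (ha : q ∈ a.dom) (hb : q ∈ b.dom) :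
    (a.add b.neg).value q = a.value q - b.value q := by
  rw [add_value a b.neg ha hb, neg_value b hb, sub_eq_add_neg]

theorem star_value (a : AlmostGlobalSection B) {q : Q} (ha : q ∈ a.dom) :
    a.star.value q = Star.star (a.value q) := by
  rw [value_of_mem _ ha, value_of_mem _ (show q ∈ a.star.dom from ha)]
  rfl

theorem smul_value (c : ℂ) (a : AlmostGlobalSection B) {q : Q} (ha : q ∈ a.dom) :
    (a.smul c).value q = c • a.value q := by
  rw [value_of_mem _ ha, value_of_mem _ (show q ∈ (a.smul c).dom from ha)]
  rfl

theorem fsmul_value [ExtremallyDisconnected Q] (f : CInfComplex Q) (a : AlmostGlobalSection B)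
    {q : Q} (hf : q ∈ f.finite) (ha : q ∈ a.dom) : (a.fsmul f).value q = f.val q • a.value q := by
  rw [value_of_mem _ ha, value_of_mem _ (show q ∈ (a.fsmul f).dom from ⟨hf, ha⟩)]
  rfl

theorem zero_value (q : Q) : (zero : AlmostGlobalSection B).value q = 0 :=
  value_of_mem _ (mem_univ q)

theorem dense_dom [BaireSpace Q] (a : AlmostGlobalSection B) : Dense a.dom :=
  dense_of_mem_residual a.dom_mem

/-- Almost global sections that agree on a comeager set are equivalent. -/
theorem equiv_of_mem_residual [BaireSpace Q] [ExtremallyDisconnected Q]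
    {a b : AlmostGlobalSection B} {D : Set Q} (hD : D ∈ residual Q)
    (h : ∀ q ∈ D, q ∈ a.dom → q ∈ b.dom → a.value q = b.value q) : a.Equiv b := by
  -- The norm of the difference vanishes on a dense set, hence everywhere, and in particular at
  -- every common point of the two domains.
  have h0 : (a.add b.neg).norm = 0 := by
    refine CInfReal.eq_of_dense (dense_of_mem_residual (inter_mem hD (inter_mem a.dom_mem
      b.dom_mem))) fun q hq => ?_
    rw [norm_toFun _ (show q ∈ (a.add b.neg).dom from hq.2), sub_value _ _ hq.2.1 hq.2.2,
      h q hq.1 hq.2.1 hq.2.2]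
    simp [CInfReal.zero_toFun]
  intro q ha hb
  have h1 : (a.add b.neg).norm.toFun q = _ :=
    norm_toFun _ (show q ∈ (a.add b.neg).dom from ⟨ha, hb⟩)
  rw [h0, CInfReal.zero_toFun, EReal.coe_eq_coe_iff, sub_value _ _ ha hb, eq_comm,
    norm_eq_zero, sub_eq_zero, value_of_mem _ ha, value_of_mem _ hb] at h1
  exact h1

/-- The section `(e / ‖a‖) • a`, where the quotient is `0` at the zeros of `‖a‖`. -/
theorem exists_norm_div_smul [BaireSpace Q] [ExtremallyDisconnected Q]
    (a : AlmostGlobalSection B) (e : CInfReal Q) :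
    ∃ b : AlmostGlobalSection B, b.dom ⊆ a.dom ∩ e.finite ∧
      ∀ q ∈ b.dom, b.value q = ((e.val q / ‖a.value q‖ : ℝ) : ℂ) • a.value q := by
  -- `N` is where the norm is nonzero and `Z` is the interior of its zero set. Only the boundary of
  -- `N`, where the quotient may fail to be continuous, is discarded.
  let N : Set Q := {q | a.norm.toFun q ≠ 0}
  have hN : IsOpen N := isOpen_ne.preimage a.norm.continuous_toFun
  let Z : Set Q := (closure N)ᶜ
  have hZ : IsOpen Z := isClosed_closure.isOpen_compl
  have hd : Dense (N ∪ Z) := by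
    intro q
    rw [closure_union]
    by_cases hq : q ∈ closure N
    · exact Or.inl hq
    · exact Or.inr (subset_closure hq)
  let F : Set Q := a.norm.finite ∩ e.finite
  have hF : IsOpen F := a.norm.isOpen_finite.inter e.isOpen_finite
  have hc : ContinuousOn (fun q => e.val q / a.norm.val q) (F ∩ N ∪ F ∩ Z) := by
    refine ContinuousOn.union_of_isOpen ?_ ?_ (hF.inter hN) (hF.inter hZ)
    · refine (e.continuousOn_val.mono fun q hq => hq.1.2).div
        (a.norm.continuousOn_val.mono fun q hq => hq.1.1) fun q hq h => hq.2 ?_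
      rw [← CInfReal.coe_val hq.1.1, h, EReal.coe_zero]
    -- On `Z` the denominator is `0`, so the quotient is constantly `0` by the convention for
    -- division by zero.
    · refine (continuousOn_const (c := (0 : ℝ))).congr fun q hq => ?_
      have h0 : a.norm.toFun q = 0 := by
        by_contra h
        exact hq.2 (subset_closure h)
      simp [CInfReal.val, h0]
  have hmem : a.dom ∩ (F ∩ N ∪ F ∩ Z) ∈ residual Q := by
    rw [← inter_union_distrib_left]
    exact inter_mem a.dom_mem (inter_mem (inter_mem a.norm.finite_mem_residual
      e.finite_mem_residual) (residual_of_dense_open (hN.union hZ) hd))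
  refine ⟨⟨a.dom ∩ (F ∩ N ∪ F ∩ Z), hmem,
    fun q => ((e.val q / a.norm.val q : ℝ) : ℂ) • a.toFun ⟨q, q.2.1⟩,
    (a.continuous_toFun.mono inter_subset_left).smul (Complex.continuous_ofReal.comp
      (continuousOn_iff_continuous_domRestrict.mp (hc.mono inter_subset_right)))⟩, ?_, ?_⟩
  · rintro q ⟨h1, h2⟩
    rw [← inter_union_distrib_left] at h2
    exact ⟨h1, h2.1.2⟩
  · intro q hq
    refine (value_of_mem _ hq).trans ?_
    rw [← CInfReal.val_eq_of_toFun_eq (a.norm_toFun hq.1), value_of_mem a hq.1]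

end AlmostGlobalSection

/-! ### Algebraic axioms and norm identities on classes of sections. -/

namespace CInfSections

open AlmostGlobalSection CInfReal

section Algebra

variable {Q : Type u} [TopologicalSpace Q] [BaireSpace Q]
  {𝔛 : Q → Type v} [∀ q, NonUnitalCStarAlgebra (𝔛 q)] {B : ContinuousCStarBundle 𝔛}

/-- The class of an almost global section. -/
def mk (a : AlmostGlobalSection B) : CInfSections B := Quotient.mk _ a

/-- Equivalence of representatives is a pointwise equation on common domains, so each axiom is the
same axiom in the fiber. -/
theorem isComplexStarAlgebra : IsComplexStarAlgebra (CInfSections B) where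
  add_assoc x y z := Quotient.inductionOn₃ x y z fun _ _ _ =>
    Quotient.sound fun _ _ _ => add_assoc _ _ _
  add_comm x y := Quotient.inductionOn₂ x y fun _ _ => Quotient.sound fun _ _ _ => add_comm _ _
  add_zero x := Quotient.inductionOn x fun _ => Quotient.sound fun _ _ _ => add_zero _
  add_neg x := Quotient.inductionOn x fun _ => Quotient.sound fun _ _ _ => add_neg_cancel _
  one_smul x := Quotient.inductionOn x fun _ => Quotient.sound fun _ _ _ => one_smul _ _
  mul_smul _ _ x := Quotient.inductionOn x fun _ => Quotient.sound fun _ _ _ => mul_smul _ _ _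
  smul_add _ x y := Quotient.inductionOn₂ x y fun _ _ =>
    Quotient.sound fun _ _ _ => smul_add _ _ _
  add_smul _ _ x := Quotient.inductionOn x fun _ => Quotient.sound fun _ _ _ => add_smul _ _ _
  mul_assoc x y z := Quotient.inductionOn₃ x y z fun _ _ _ =>
    Quotient.sound fun _ _ _ => mul_assoc _ _ _
  mul_add x y z := Quotient.inductionOn₃ x y z fun _ _ _ =>
    Quotient.sound fun _ _ _ => mul_add _ _ _
  add_mul x y z := Quotient.inductionOn₃ x y z fun _ _ _ =>
    Quotient.sound fun _ _ _ => add_mul _ _ _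
  smul_mul _ x y := Quotient.inductionOn₂ x y fun _ _ =>
    Quotient.sound fun _ _ _ => smul_mul_assoc _ _ _
  mul_smul_comm _ x y := Quotient.inductionOn₂ x y fun _ _ =>
    Quotient.sound fun _ _ _ => mul_smul_comm _ _ _
  star_star x := Quotient.inductionOn x fun _ => Quotient.sound fun _ _ _ => star_star _
  star_add x y := Quotient.inductionOn₂ x y fun _ _ => Quotient.sound fun _ _ _ => star_add _ _
  star_smul _ x := Quotient.inductionOn x fun _ => Quotient.sound fun _ _ _ => star_smul _ _
  star_mul x y := Quotient.inductionOn₂ x y fun _ _ => Quotient.sound fun _ _ _ => star_mul _ _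

end Algebra

variable {Q : Type u} [TopologicalSpace Q] [BaireSpace Q] [ExtremallyDisconnected Q]
  {𝔛 : Q → Type v} [∀ q, NonUnitalCStarAlgebra (𝔛 q)] {B : ContinuousCStarBundle 𝔛}

theorem isVectorNorm : IsVectorNorm (norm : CInfSections B → CInfReal Q) where
  nonneg x := Quotient.inductionOn x fun a => le_of_dense a.dense_dom fun q hq => by
    change _ ≤ a.norm.toFun q
    rw [a.norm_toFun hq, zero_toFun, EReal.coe_le_coe_iff]
    exact norm_nonneg _
  eq_zero_iff x := Quotient.inductionOn x fun a => by
    change a.norm = 0 ↔ _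
    constructor
    · intro h
      refine Quotient.sound (equiv_of_mem_residual univ_mem fun q _ hq _ => ?_)
      have h1 := a.norm_toFun hq
      rw [h, zero_toFun, EReal.coe_eq_coe_iff, eq_comm, norm_eq_zero] at h1
      rw [h1, zero_value]
    · intro h
      have h' : a.norm = (zero : AlmostGlobalSection B).norm := norm_congr (Quotient.exact h)
      refine h'.trans (eq_of_dense dense_univ fun q _ => ?_)
      rw [norm_toFun _ (show q ∈ zero.dom from mem_univ q), zero_value, norm_zero, zero_toFun]
  smul c x := Quotient.inductionOn x fun a => eq_of_dense a.dense_dom fun q hq => by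
    refine ((a.smul c).norm_toFun hq).trans ?_
    rw [a.smul_value c hq, norm_smul]
    exact (mul_toFun_of_eq (const_toFun _ q) (a.norm_toFun hq)).symm
  add_le x y := Quotient.inductionOn₂ x y fun a b => le_of_dense (a.add b).dense_dom fun q hq => by
    refine ((a.add b).norm_toFun hq).trans_le ?_
    rw [add_value _ _ hq.1 hq.2]
    refine le_of_le_of_eq ?_ (add_toFun_of_eq (a.norm_toFun hq.1) (b.norm_toFun hq.2)).symm
    exact EReal.coe_le_coe_iff.mpr (norm_add_le _ _)

theorem norm_fsmul (f : CInfComplex Q) (x : CInfSections B) :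
    norm (f • x) = f.modulus * norm x :=
  Quotient.inductionOn x fun a => eq_of_dense (a.fsmul f).dense_dom fun q hq => by
    refine ((a.fsmul f).norm_toFun hq).trans ?_
    rw [a.fsmul_value f hq.1 hq.2, norm_smul]
    exact (mul_toFun_of_eq (CInfComplex.modulus_toFun hq.1) (a.norm_toFun hq.2)).symm

theorem norm_mul_le (x y : CInfSections B) : norm (x * y) ≤ norm x * norm y :=
  Quotient.inductionOn₂ x y fun a b => le_of_dense (a.mul b).dense_dom fun q hq => by
    refine ((a.mul b).norm_toFun hq).trans_le ?_
    rw [mul_value _ _ hq.1 hq.2]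
    refine le_of_le_of_eq ?_ (mul_toFun_of_eq (a.norm_toFun hq.1) (b.norm_toFun hq.2)).symm
    exact EReal.coe_le_coe_iff.mpr (_root_.norm_mul_le _ _)

theorem norm_star (x : CInfSections B) : norm (star x) = norm x :=
  Quotient.inductionOn x fun a => eq_of_dense a.dense_dom fun q hq => by
    refine (a.star.norm_toFun hq).trans ?_
    rw [a.star_value hq, _root_.norm_star]
    exact (a.norm_toFun hq).symm

theorem norm_star_mul_self (x : CInfSections B) : norm (star x * x) = norm x * norm x :=
  Quotient.inductionOn x fun a => eq_of_dense a.dense_dom fun q hq => by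
    refine ((a.star.mul a).norm_toFun ⟨hq, hq⟩).trans ?_
    rw [mul_value a.star a hq hq, a.star_value hq, CStarRing.norm_star_mul_self]
    exact (mul_toFun_of_eq (a.norm_toFun hq) (a.norm_toFun hq)).symm

/-! ### Decomposability and `bo`-completeness. -/

theorem isDecomposable : IsDecomposable (norm : CInfSections B → CInfReal Q) := by
  intro e₁ e₂ x
  refine Quotient.inductionOn x fun a h₁ h₂ h => ?_
  change a.norm = e₁ + e₂ at h
  obtain ⟨b₁, hb₁, hv₁⟩ := a.exists_norm_div_smul e₁
  obtain ⟨b₂, hb₂, hv₂⟩ := a.exists_norm_div_smul e₂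
  have hsum : ∀ q ∈ b₁.dom, q ∈ b₂.dom → ‖a.value q‖ = e₁.val q + e₂.val q := by
    intro q h1 h2
    have := a.norm_toFun (hb₁ h1).1
    rw [h, add_toFun (hb₁ h1).2 (hb₂ h2).2, EReal.coe_eq_coe_iff] at this
    exact this.symm
  have hpos : ∀ {e : CInfReal Q}, 0 ≤ e → ∀ q, 0 ≤ e.val q := fun {e} he q =>
    EReal.toReal_nonneg (he q)
  have hD : b₁.dom ∩ b₂.dom ∈ residual Q := inter_mem b₁.dom_mem b₂.dom_mem
  have hnorm : ∀ (b : AlmostGlobalSection B) (e : CInfReal Q), 0 ≤ e → b.dom ⊆ a.dom ∩ e.finite →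
      (∀ q ∈ b.dom, b.value q = ((e.val q / ‖a.value q‖ : ℝ) : ℂ) • a.value q) →
      (∀ q ∈ b₁.dom ∩ b₂.dom, q ∈ b.dom ∧ (‖a.value q‖ = 0 → e.val q = 0)) → b.norm = e := by
    intro b e he hb hv h0
    refine eq_of_dense (dense_of_mem_residual hD) fun q hq => ?_
    obtain ⟨hqb, h0⟩ := h0 q hq
    rw [b.norm_toFun hqb, ← coe_val (hb hqb).2, EReal.coe_eq_coe_iff, hv q hqb, norm_smul,
      Complex.norm_real, Real.norm_of_nonneg (div_nonneg (hpos he q) (norm_nonneg _))]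
    -- Cancellation also holds at zeros of `a`: there `e` vanishes, being one of two nonnegative
    -- terms with sum `0`.
    exact div_mul_cancel_of_imp h0
  refine ⟨mk b₁, mk b₂, ?_, hnorm b₁ e₁ h₁ hb₁ hv₁ fun q hq => ⟨hq.1, ?_⟩,
    hnorm b₂ e₂ h₂ hb₂ hv₂ fun q hq => ⟨hq.2, ?_⟩⟩
  · refine Quotient.sound (equiv_of_mem_residual (b := b₁.add b₂) hD fun q hq _ _ => ?_)
    rw [add_value _ _ hq.1 hq.2, hv₁ q hq.1, hv₂ q hq.2, ← add_smul, ← Complex.ofReal_add,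
      ← add_div, ← hsum q hq.1 hq.2]
    by_cases h0 : ‖a.value q‖ = 0
    · rw [norm_eq_zero.mp h0, smul_zero]
    · rw [div_self h0, Complex.ofReal_one, one_smul]
  · intro h0
    linarith [hsum q hq.1 hq.2, hpos h₁ q, hpos h₂ q]
  · intro h0
    linarith [hsum q hq.1 hq.2, hpos h₁ q, hpos h₂ q]

theorem norm_sub_toFun (a b : AlmostGlobalSection B) {q : Q} (ha : q ∈ a.dom) (hb : q ∈ b.dom) :
    (norm (mk a + -mk b : CInfSections B)).toFun q =
      (‖a.value q - b.value q‖ : ℝ) := by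
  rw [← sub_value a b ha hb]
  exact (a.add b.neg).norm_toFun ⟨ha, hb⟩

theorem isBoComplete : IsBoComplete.{u, max u v, w} (norm : CInfSections B → CInfReal Q) := by
  intro A _ _ _ x ⟨Γ, hΓ, hΓd, hΓn, e, he, hglb, hx⟩
  obtain ⟨a, rfl⟩ : ∃ a : A → AlmostGlobalSection B, x = fun α => mk (a α) :=
    ⟨fun α => (x α).out, funext fun α => (Quotient.out_eq _).symm⟩
  have he0 : ∀ γ q, 0 ≤ (e γ).toFun q := fun γ q => hglb.1 (mem_range_self γ) q
  have hcauchy : ∀ γ, ∃ α₀, ∀ α β, α₀ ≤ α → α₀ ≤ β → ∀ q ∈ (a α).dom, q ∈ (a β).dom →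
      (‖(a α).value q - (a β).value q‖ : EReal) ≤ (e γ).toFun q := by
    intro γ
    obtain ⟨⟨α₁, α₂⟩, h⟩ := hx γ
    -- Directedness replaces the threshold in `A × A` by a single index.
    obtain ⟨α₀, h₁, h₂⟩ := exists_ge_ge α₁ α₂
    refine ⟨α₀, fun α β hα hβ q hqα hqβ => ?_⟩
    have h3 := h (α, β) ⟨h₁.trans hα, h₂.trans hβ⟩ q
    refine le_of_eq_of_le ?_ h3
    -- The `bo`-limit of the differences is `0`, so the norm to be evaluated is that of `0 - (a α -
    -- a β)`.
    refine Eq.trans ?_ (norm_toFun (zero.add ((a α).add (a β).neg).neg)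
      ⟨mem_univ q, hqα, hqβ⟩).symm
    rw [add_value zero ((a α).add (a β).neg).neg (mem_univ q) ⟨hqα, hqβ⟩,
      neg_value ((a α).add (a β).neg) ⟨hqα, hqβ⟩, sub_value _ _ hqα hqβ, zero_value, zero_add,
      norm_neg]
  choose i hi using hcauchy
  have hcross : ∀ γ δ α β, i γ ≤ α → i δ ≤ β → ∀ q ∈ (a α).dom, q ∈ (a β).dom →
      (‖(a α).value q - (a β).value q‖ : EReal) ≤ (e γ).toFun q + (e δ).toFun q := by
    intro γ δ α β hα hβ q hqα hqβ
    -- Compare both sections with `a κ` beyond both thresholds. Its domain may miss `q`, so the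
    -- estimate is proved on a dense set and extended by continuity.
    obtain ⟨κ, hκ₁, hκ₂⟩ := exists_ge_ge (i γ) (i δ)
    rw [← norm_sub_toFun _ _ hqα hqβ]
    -- Addition on `EReal` is continuous here because neither term takes the value `⊥`.
    have hcont : Continuous fun q => (e γ).toFun q + (e δ).toFun q :=
      continuous_iff_continuousAt.mpr fun q =>
        ContinuousAt.comp (f := fun q => ((e γ).toFun q, (e δ).toFun q))
          (EReal.continuousAt_add (Or.inr (ne_bot_of_le_ne_bot EReal.zero_ne_bot (he0 δ q)))
            (Or.inl (ne_bot_of_le_ne_bot EReal.zero_ne_bot (he0 γ q))))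
          ((e γ).continuous_toFun.prodMk (e δ).continuous_toFun).continuousAt
    refine (dense_of_mem_residual (inter_mem (a κ).dom_mem (inter_mem (a α).dom_mem
      (a β).dom_mem))).induction (P := fun q => (norm (mk (a α) +
        -mk (a β) : CInfSections B)).toFun q ≤ (e γ).toFun q + (e δ).toFun q) ?_
      (isClosed_le (CInfReal.continuous_toFun _) hcont) q
    rintro q ⟨hqκ, hqα, hqβ⟩
    rw [norm_sub_toFun _ _ hqα hqβ]
    refine le_trans ?_ (add_le_add (hi γ α κ hα hκ₁ q hqα hqκ) (hi δ κ β hκ₂ hβ q hqκ hqβ))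
    rw [← EReal.coe_add, EReal.coe_le_coe_iff]
    exact norm_sub_le_norm_sub_add_norm_sub _ _ _
  have hpos : ∀ n : ℕ, (0 : ℝ) < 1 / ((n : ℝ) + 1) := fun n => Nat.one_div_pos_of_nat
  -- At each point of its domain, `s n` equals some `a (i γ)` whose error bound `e γ` is below
  -- `1/(n+1)` there; by `hcross`, `s n` and `s m` then differ by at most `1/(n+1) + 1/(m+1)`.
  have hglue : ∀ n : ℕ, ∃ s : AlmostGlobalSection B, ∀ q ∈ s.dom, ∃ γ,
      (e γ).toFun q < (1 / ((n : ℝ) + 1) : ℝ) ∧ q ∈ (a (i γ)).dom ∧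
        s.value q = (a (i γ)).value q := fun n =>
    exists_glue (fun γ => isOpen_Iio.preimage (e γ).continuous_toFun)
      (dense_iUnion_lt_of_isGLB_zero hglb (hpos n)) fun γ => a (i γ)
  choose s hs using hglue
  obtain ⟨u, hud, hu⟩ := exists_tendsto_value (s := s) tendsto_one_div_add_atTop_nhds_zero_nat
    fun n m q hqn hqm => by
      obtain ⟨γ, hγ, hqγ, hγv⟩ := hs n q hqn
      obtain ⟨δ, hδ, hqδ, hδv⟩ := hs m q hqm
      rw [hγv, hδv, ← EReal.coe_le_coe_iff, EReal.coe_add]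
      exact (hcross γ δ _ _ le_rfl le_rfl q hqγ hqδ).trans (add_le_add hγ.le hδ.le)
  refine ⟨mk u, Γ, hΓ, hΓd, hΓn, e, he, hglb, fun γ => ⟨i γ, fun α hα => ?_⟩⟩
  refine le_of_dense (dense_of_mem_residual (inter_mem (e γ).finite_mem_residual
    (inter_mem u.dom_mem (a α).dom_mem))) ?_
  rintro q ⟨hqe, hqu, hqα⟩
  change (norm (mk u + -mk (a α))).toFun q ≤ _
  rw [norm_sub_toFun _ _ hqu hqα, ← coe_val hqe, EReal.coe_le_coe_iff]
  -- By `hcross`, `s n` is within `1/(n+1) + e γ` of `a α` at `q`; now `n → ∞`. Finiteness of `e γ`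
  -- at `q` makes this a limit of real numbers.
  have hr : Tendsto (fun n : ℕ => 1 / ((n : ℝ) + 1) + (e γ).val q) atTop (𝓝 ((e γ).val q)) := by
    simpa using tendsto_one_div_add_atTop_nhds_zero_nat.add_const ((e γ).val q)
  refine le_of_tendsto_of_tendsto' ((hu q hqu).sub_const _).norm hr fun n => ?_
  have hqn : q ∈ (s n).dom := by
    rw [hud] at hqu
    exact mem_iInter.mp hqu n
  obtain ⟨δ, hδ, hqδ, hδv⟩ := hs n q hqn
  rw [hδv, ← EReal.coe_le_coe_iff, EReal.coe_add, coe_val hqe]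
  exact (hcross δ γ _ _ le_rfl hα q hqδ hqα).trans (add_le_add hδ.le le_rfl)

end CInfSections

end StoneanBundle

/-- Compactness and the Hausdorff property enter through the Baire category theorem. In the module
axioms, membership of `q` in the domains of both sides supplies the finiteness needed to evaluate
the coefficients. -/
theorem theorem1 {Q : Type u} [TopologicalSpace Q] [CompactSpace Q] [T2Space Q]
    [ExtremallyDisconnected Q] {𝔛 : Q → Type v} [∀ q, NonUnitalCStarAlgebra (𝔛 q)]
    (B : StoneanBundle.ContinuousCStarBundle 𝔛) :
    StoneanBundle.IsCStarAlgebraOver.{u, max u v, w} Q (StoneanBundle.CInfSections B)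
      StoneanBundle.CInfSections.norm where
  isComplexStarAlgebra := StoneanBundle.CInfSections.isComplexStarAlgebra
  one_smul x := Quotient.inductionOn x fun _ => Quotient.sound fun q _ _ =>
    (congrArg (· • _) (StoneanBundle.CInfComplex.one_val q)).trans (one_smul _ _)
  mul_smul _ _ x := Quotient.inductionOn x fun _ => Quotient.sound fun _ _ h =>
    (congrArg (· • _) (StoneanBundle.CInfComplex.mul_val h.1 h.2.1)).trans (mul_smul _ _ _)
  smul_add _ x y := Quotient.inductionOn₂ x y fun _ _ =>
    Quotient.sound fun _ _ _ => smul_add _ _ _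
  add_smul _ _ x := Quotient.inductionOn x fun _ => Quotient.sound fun _ _ h =>
    (congrArg (· • _) (StoneanBundle.CInfComplex.add_val h.1.1 h.2.1)).trans (add_smul _ _ _)
  const_smul c x := Quotient.inductionOn x fun _ => Quotient.sound fun q _ _ =>
    congrArg (· • _) (StoneanBundle.CInfComplex.const_val c q)
  star_smul _ x := Quotient.inductionOn x fun _ => Quotient.sound fun _ h _ =>
    (star_smul _ _).trans (congrArg (· • _) (StoneanBundle.CInfComplex.conj_val h.1).symm)
  smul_mul _ x y := Quotient.inductionOn₂ x y fun _ _ =>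
    Quotient.sound fun _ _ _ => smul_mul_assoc _ _ _
  mul_smul_comm _ x y := Quotient.inductionOn₂ x y fun _ _ =>
    Quotient.sound fun _ _ _ => (mul_smul_comm _ _ _).symm
  isBanachKantorovich :=
    ⟨StoneanBundle.CInfSections.isVectorNorm, StoneanBundle.CInfSections.isDecomposable,
      StoneanBundle.CInfSections.isBoComplete⟩
  norm_smul := StoneanBundle.CInfSections.norm_fsmul
  norm_mul_le := StoneanBundle.CInfSections.norm_mul_le
  norm_star := StoneanBundle.CInfSections.norm_star
  norm_star_mul_self := StoneanBundle.CInfSections.norm_star_mul_self
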